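/- Let $\mathbf F$ be an arbitrary field. For an automorphism $\sigma$ of $\mathbf F$ with $\sigma\circ\sigma=\mathrm{id}$ (possibly $\sigma=\mathrm{id}$), let $\langle x,y\rangle=\sum_i\sigma(x_i)y_i$ on $\mathbf F^d$, and let $\mathrm U(d,\mathbf F,\sigma)$ be the group of all $g\in\mathrm{GL}(d,\mathbf F)$ with $\langle gx,gy\rangle=\langle x,y\rangle$ for all $x,y\in\mathbf F^d$. The group $\mathrm{GL}(d,\mathbf F)\times S_n$ acts on $n$-tuples of subspaces of $\mathbf F^d$ by $(g,\pi)\cdot(V_i)_{i\in[n]}=(gV_{\pi^{-1}(i)})_{i\in[n]}$. For $r,d,n\ge 1$, let $Q(r,d,n,\mathbf F)$ be the set of pairs $(A,B)$ of $n$-tuples of $d\times r$ matrices with entries in $\{0,1\}\subseteq\mathbf F$ such that $\operatorname{rank}A_i=\operatorname{rank}B_i=r$ (over $\mathbf F$) for all $i\in[n]$; the size of such an instance is $M(A,B)=2rdn$. - $\mathscr P_1(r,\mathbf F,\sigma)$ is the problem: given $(A,B)\in\bigcup_{d,n\ge1}Q(r,d,n,\mathbf F)$, decide whether there is $(g,\pi)\in\mathrm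 U(d,\mathbf F,\sigma)\times S_n$ with $(g,\pi)\cdot(\operatorname{im}A_i)_{i\in[n]}=(\operatorname{im}B_i)_{i\in[n]}$. - $\mathscr P_2(\mathbf F)$ is the problem: given $(A,B)\in\bigcup_{r,d,n\ge1}Q(r,d,n,\mathbf F)$, decide whether there is $(g,\pi)\in\mathrm{GL}(d,\mathbf F)\times S_n$ with $(g,\pi)\cdot(\operatorname{im}A_i)_{i\in[n]}=(\operatorname{im}B_i)_{i\in[n]}$. A decision problem $P$ with size measure $M$ is called GI-hard if there is an algorithm (a random access machine with unit-cost assignments, additions, subtractions, memory accesses and tests) that, given a black box which answers any instance $x$ of $P$ in time polynomial in $M(x)$, decides whether two finite simple graphs $G,H$ (given by incidence matrices) are isomorphic, with total runtime, including the time spent by the black box, polynomial in the numbers of vertices and edges of $G$ and $H$. **Theorem.** (a) For every integer $r\ge1$, every field $\mathbf F$ and every automorphism $\sigma$ of $\mathbf F$ with $\sigma\circ\sigma=\mathrm{id}$, the problem $\mathscr P_1(r,\mathbf F,\sigma)$ is GI-hard. (b) For every field $\mathbf F$, the problem $\mathscr P_2(\mathbf F)$ is GI-hard. -/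

import Mathlib

namespace SubspaceIso

/-! ## Decision problems -/

/-- A decision problem: a set of instances, the answer map, the measure of the size of an instance,
and the way in which an instance is written into a one-sided infinite memory. -/
structure DecisionProblem where
  /-- the problem instances -/
  Inst : Type
  /-- the instances whose answer is `yes` -/
  yes : Inst → Prop
  /-- the size of an instance -/
  size : Inst → ℕ
  /-- `holds m x`: the memory `m` contains (from cell `0` on) the representation of `x` -/
  holds : (ℕ → ℕ) → Inst → Prop
  /-- a memory represents at most one instance -/
  holds_unique : ∀ m x y, holds m x → holds m y → x = y
  /-- every instance can be written into some memory -/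
  holds_exists : ∀ x, ∃ m, holds m x

/-! ## Random access machines with a black box

The machine has registers and arrays holding natural numbers (a program mentions only finitely many
registers and arrays by name; the cells of an array are addressed indirectly, through registers).
Assignments, additions, truncated subtractions, memory accesses and tests have unit cost; there is
no multiplication, so that the model is polynomially equivalent to Turing machines. -/

/-- The state of a machine: the registers, and the contents of the arrays. -/
structure State where
  /-- `reg x` is the content of register `x` -/
  reg : ℕ → ℕ
  /-- `arr a i` is the content of cell `i` of array `a` -/
  arr : ℕ → ℕ → ℕ

/-- Overwrite register `x` with `v`. -/
def State.setReg (s : State) (x v : ℕ) : State :=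
  { s with reg := Function.update s.reg x v }

/-- Overwrite cell `i` of array `a` with `v`. -/
def State.setArr (s : State) (a i v : ℕ) : State :=
  { s with arr := Function.update s.arr a (Function.update (s.arr a) i v) }

/-- Programs. -/
inductive Prog : Type
  /-- do nothing -/
  | skip : Prog
  /-- `reg x := k` -/
  | const (x k : ℕ) : Prog
  /-- `reg x := reg y + reg z` -/
  | add (x y z : ℕ) : Prog
  /-- `reg x := reg y - reg z` (truncated) -/
  | sub (x y z : ℕ) : Prog
  /-- `reg x := arr a (reg y)` -/
  | read (x a y : ℕ) : Prog
  /-- `arr a (reg x) := reg y` -/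
  | write (a x y : ℕ) : Prog
  /-- first `c`, then `c'` -/
  | seq (c c' : Prog) : Prog
  /-- if `reg x ≠ 0` then `c` else `c'` -/
  | ite (x : ℕ) (c c' : Prog) : Prog
  /-- while `reg x ≠ 0` do `c` -/
  | loop (x : ℕ) (c : Prog) : Prog
  /-- ask the black box about the instance held by array `a`, and put the answer (`1` for `yes`,
  `0` for `no`) into register `x` -/
  | query (x a : ℕ) : Prog

/-- `Exec P time c s t s'`: with a black box for the decision problem `P` that takes time `time w`
on the instance `w`, the program `c` started in the state `s` halts in the state `s'`, and its
runtime is `t`. A program may only ask about memory contents that represent an instance of `P`: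
otherwise it is stuck, and has no execution. -/
inductive Exec (P : DecisionProblem) (time : P.Inst → ℕ) : Prog → State → ℕ → State → Prop
  | skip (s : State) : Exec P time .skip s 1 s
  | const (s : State) (x k : ℕ) : Exec P time (.const x k) s 1 (s.setReg x k)
  | add (s : State) (x y z : ℕ) :
      Exec P time (.add x y z) s 1 (s.setReg x (s.reg y + s.reg z))
  | sub (s : State) (x y z : ℕ) :
      Exec P time (.sub x y z) s 1 (s.setReg x (s.reg y - s.reg z))
  | read (s : State) (x a y : ℕ) :
      Exec P time (.read x a y) s 1 (s.setReg x (s.arr a (s.reg y)))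
  | write (s : State) (a x y : ℕ) :
      Exec P time (.write a x y) s 1 (s.setArr a (s.reg x) (s.reg y))
  | seq {c c' : Prog} {s s' s'' : State} {t t' : ℕ} (h : Exec P time c s t s')
      (h' : Exec P time c' s' t' s'') : Exec P time (.seq c c') s (t + t') s''
  | ite_nonzero {x : ℕ} {c c' : Prog} {s s' : State} {t : ℕ} (hx : s.reg x ≠ 0)
      (h : Exec P time c s t s') : Exec P time (.ite x c c') s (t + 1) s'
  | ite_zero {x : ℕ} {c c' : Prog} {s s' : State} {t : ℕ} (hx : s.reg x = 0)
      (h : Exec P time c' s t s') : Exec P time (.ite x c c') s (t + 1) s'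
  | loop_done {x : ℕ} {c : Prog} {s : State} (hx : s.reg x = 0) :
      Exec P time (.loop x c) s 1 s
  | loop_step {x : ℕ} {c : Prog} {s s' s'' : State} {t t' : ℕ} (hx : s.reg x ≠ 0)
      (h : Exec P time c s t s') (h' : Exec P time (.loop x c) s' t' s'') :
      Exec P time (.loop x c) s (t + t' + 1) s''
  | query_yes (s : State) (x a : ℕ) (w : P.Inst) (hw : P.holds (s.arr a) w) (hy : P.yes w) :
      Exec P time (.query x a) s (time w + 1) (s.setReg x 1)
  | query_no (s : State) (x a : ℕ) (w : P.Inst) (hw : P.holds (s.arr a) w) (hy : ¬ P.yes w) :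
      Exec P time (.query x a) s (time w + 1) (s.setReg x 0)

/-! ## Graph isomorphism -/

/-- A finite simple graph with labelled vertices and labelled edges. -/
structure LabelledGraph where
  /-- the number of vertices -/
  nV : ℕ
  /-- the number of edges -/
  nE : ℕ
  /-- the graph -/
  graph : SimpleGraph (Fin nV)
  /-- the labelling of the edges -/
  edge : Fin nE ≃ graph.edgeSet

/-- The incidence matrix. -/
def LabelledGraph.inc (G : LabelledGraph) : Matrix (Fin G.nV) (Fin G.nE) Bool :=
  fun v i => decide (v ∈ (G.edge i : Sym2 (Fin G.nV)))

/-- The cells `base, base + 1, …` of the memory `m` contain the bits of the matrices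
`A 0, A 1, …`, each of them row after row. -/
def HoldsBits (m : ℕ → ℕ) (base : ℕ) {n d r : ℕ} (A : Fin n → Matrix (Fin d) (Fin r) Bool) : Prop :=
  ∀ (i : Fin n) (a : Fin d) (b : Fin r),
    m (base + ((i * d + a) * r + b)) = (A i a b).toNat

theorem HoldsBits.unique {m : ℕ → ℕ} {base n d r : ℕ}
    {A B : Fin n → Matrix (Fin d) (Fin r) Bool} (hA : HoldsBits m base A)
    (hB : HoldsBits m base B) : A = B := by
  funext i a b
  have h := (hA i a b).symm.trans (hB i a b)
  revert h
  cases A i a b <;> cases B i a b <;> simp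

theorem digit_aux {r q q' b b' : ℕ} (hb : b < r) (hb' : b' < r) (h : q * r + b = q' * r + b') :
    q = q' ∧ b = b' := by
  have hr : 0 < r := by omega
  have h1 : (q * r + b) / r = q := by
    rw [add_comm, Nat.add_mul_div_right _ _ hr, Nat.div_eq_of_lt hb, zero_add]
  have h2 : (q' * r + b') / r = q' := by
    rw [add_comm, Nat.add_mul_div_right _ _ hr, Nat.div_eq_of_lt hb', zero_add]
  have hq : q = q' := by rw [← h1, ← h2, h]
  subst hq
  exact ⟨rfl, by omega⟩

theorem index_lt {n d r : ℕ} (i : Fin n) (a : Fin d) (b : Fin r) :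
    (i.1 * d + a) * r + b < n * d * r := by
  have h1 : i.1 * d + a + 1 ≤ n * d := by
    have := Nat.mul_le_mul_right d (Nat.succ_le_of_lt i.2)
    rw [Nat.succ_mul] at this
    have := a.2
    omega
  have h2 := Nat.mul_le_mul_right r h1
  rw [Nat.succ_mul] at h2
  have := b.2
  omega

theorem exists_block {n d r : ℕ} (A : Fin n → Matrix (Fin d) (Fin r) Bool) :
    ∃ m : ℕ → ℕ, HoldsBits m 0 A := by
  classical
  refine ⟨fun k => if ∃ (i : Fin n) (a : Fin d) (b : Fin r),
    k = (i * d + a) * r + b ∧ A i a b = true then 1 else 0, fun i a b => ?_⟩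
  rw [zero_add]
  cases hA : A i a b
  · refine if_neg ?_
    rintro ⟨i', a', b', h, hA'⟩
    obtain ⟨h1, h2⟩ := digit_aux b.2 b'.2 h
    obtain ⟨h3, h4⟩ := digit_aux a.2 a'.2 h1
    rw [← Fin.ext h2, ← Fin.ext h3, ← Fin.ext h4, hA] at hA'
    exact absurd hA' (by simp)
  · exact if_pos ⟨i, a, b, rfl, hA⟩

/-- A header followed by two blocks can be written into a memory. -/
theorem exists_memory (h : ℕ → ℕ) (base : ℕ) {n d r n' d' r' : ℕ}
    (A : Fin n → Matrix (Fin d) (Fin r) Bool) (B : Fin n' → Matrix (Fin d') (Fin r') Bool) :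
    ∃ m : ℕ → ℕ, (∀ k < base, m k = h k) ∧ HoldsBits m base A ∧
      HoldsBits m (base + n * d * r) B := by
  obtain ⟨mA, hA⟩ := exists_block A
  obtain ⟨mB, hB⟩ := exists_block B
  refine ⟨fun k => if k < base then h k else
    if k < base + n * d * r then mA (k - base) else mB (k - (base + n * d * r)),
    fun k hk => if_pos hk, fun i a b => ?_, fun i a b => ?_⟩
  · have h1 := index_lt i a b
    have h2 := hA i a b
    simp only [zero_add] at h2
    simp only [Nat.not_lt.mpr (Nat.le_add_right base _), if_false, Nat.add_lt_add_iff_left, h1,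
      if_true, Nat.add_sub_cancel_left, h2]
  · have h2 := hB i a b
    simp only [zero_add] at h2
    have h3 : ¬ (base + n * d * r + ((i * d' + a) * r' + b) < base) := by omega
    have h4 : ¬ (base + n * d * r + ((i * d' + a) * r' + b) < base + n * d * r) := by omega
    simp only [h3, h4, if_false, Nat.add_sub_cancel_left, h2]

theorem LabelledGraph.eq_of_inc {nV nE : ℕ} {g g' : SimpleGraph (Fin nV)}
    {l : Fin nE ≃ g.edgeSet} {l' : Fin nE ≃ g'.edgeSet}
    (h : (LabelledGraph.mk nV nE g l).inc = (LabelledGraph.mk nV nE g' l').inc) :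
    LabelledGraph.mk nV nE g l = LabelledGraph.mk nV nE g' l' := by
  have hl : ∀ i, (l i : Sym2 (Fin nV)) = l' i := by
    intro i
    refine Sym2.ext fun v => ?_
    have hv := congrFun (congrFun h v) i
    simpa [LabelledGraph.inc] using hv
  have hs : g.edgeSet = g'.edgeSet := by
    ext z
    constructor
    · intro hz
      obtain ⟨i, hi⟩ := l.surjective ⟨z, hz⟩
      have h1 := hl i
      rw [hi] at h1
      change z = (l' i : Sym2 (Fin nV)) at h1
      rw [h1]
      exact (l' i).2
    · intro hz
      obtain ⟨i, hi⟩ := l'.surjective ⟨z, hz⟩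
      have h1 := hl i
      rw [hi] at h1
      change (l i : Sym2 (Fin nV)) = z at h1
      rw [← h1]
      exact (l i).2
  obtain rfl := SimpleGraph.edgeSet_inj.mp hs
  have : l = l' := Equiv.ext fun i => Subtype.ext (hl i)
  rw [this]

/-- Graph isomorphism. A pair of graphs is represented by the four numbers of vertices and edges
(in cells `0` to `3`), followed by the two incidence matrices. -/
def graphIsomorphism : DecisionProblem where
  Inst := LabelledGraph × LabelledGraph
  yes x := Nonempty (x.1.graph ≃g x.2.graph)
  size x := x.1.nV * x.1.nE + x.2.nV * x.2.nE
  holds m x := m 0 = x.1.nV ∧ m 1 = x.1.nE ∧ m 2 = x.2.nV ∧ m 3 = x.2.nE ∧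
    HoldsBits m 4 (fun _ : Fin 1 => x.1.inc) ∧
    HoldsBits m (4 + 1 * x.1.nV * x.1.nE) (fun _ : Fin 1 => x.2.inc)
  holds_unique := by
    rintro m ⟨⟨n, e, g, l⟩, ⟨n', e', g', l'⟩⟩ ⟨⟨k, f, u, v⟩, ⟨k', f', u', v'⟩⟩
      ⟨h0, h1, h2, h3, hA, hB⟩ ⟨h0', h1', h2', h3', hA', hB'⟩
    dsimp only at h0 h1 h2 h3 h0' h1' h2' h3'
    obtain rfl : n = k := h0.symm.trans h0'
    obtain rfl : e = f := h1.symm.trans h1'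
    obtain rfl : n' = k' := h2.symm.trans h2'
    obtain rfl : e' = f' := h3.symm.trans h3'
    exact Prod.ext (LabelledGraph.eq_of_inc (congrFun (hA.unique hA') 0))
      (LabelledGraph.eq_of_inc (congrFun (hB.unique hB') 0))
  holds_exists x := by
    obtain ⟨m, h, hA, hB⟩ := exists_memory
      (fun k => if k = 0 then x.1.nV else if k = 1 then x.1.nE else if k = 2 then x.2.nV
        else x.2.nE) 4 (fun _ : Fin 1 => x.1.inc) (fun _ : Fin 1 => x.2.inc)
    exact ⟨m, by simpa using h 0 (by simp), by simpa using h 1 (by simp),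
      by simpa using h 2 (by simp), by simpa using h 3 (by simp), hA, hB⟩

/-- `P` is GI-hard: there is a program that, given any black box for `P` whose time is polynomial in
the size of the instance, solves graph isomorphism, and whose runtime (which includes the time spent
by the black box) is polynomial in the numbers of vertices and edges of the input graphs. The input
is in array `0`, all registers and all other arrays are initially zero; the answer is left in
register `0`. -/
def GIHard (P : DecisionProblem) : Prop :=
  ∃ c : Prog, ∀ time : P.Inst → ℕ,
    (∃ q : Polynomial ℕ, ∀ w, time w ≤ q.eval (P.size w)) →
    ∃ p : Polynomial ℕ, ∀ (G H : LabelledGraph) (s : State),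
      graphIsomorphism.holds (s.arr 0) (G, H) → (∀ x, s.reg x = 0) →
      (∀ a, a ≠ 0 → ∀ i, s.arr a i = 0) →
      ∃ (t : ℕ) (s' : State), Exec P time c s t s' ∧
        t ≤ p.eval (G.nV + G.nE + H.nV + H.nE) ∧
        (graphIsomorphism.yes (G, H) → s'.reg 0 = 1) ∧
        (¬ graphIsomorphism.yes (G, H) → s'.reg 0 = 0)

/-! ## Isomorphism of tuples of subspaces up to permutation -/

section Subspaces

variable {F : Type*} [Field F]

/-- The form `⟨x, y⟩ = ∑ i, σ (x i) * y i` on `F ^ d`. -/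
def herm (σ : F ≃+* F) {d : ℕ} (x y : Fin d → F) : F :=
  ∑ i, σ (x i) * y i

/-- The group `U(d, F, σ)` of all `g ∈ GL(d, F)` that preserve the form. -/
def unitary (d : ℕ) (σ : F ≃+* F) : Subgroup (Matrix.GeneralLinearGroup (Fin d) F) where
  carrier := {g | ∀ x y : Fin d → F,
    herm σ ((g : Matrix (Fin d) (Fin d) F).mulVec x) ((g : Matrix (Fin d) (Fin d) F).mulVec y) =
      herm σ x y}
  one_mem' := by
    intro x y
    simp
  mul_mem' := by
    intro g h hg hh x y
    simp only [Units.val_mul, ← Matrix.mulVec_mulVec]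
    rw [hg, hh]
  inv_mem' := by
    intro g hg x y
    rw [← hg]
    simp only [Matrix.mulVec_mulVec, ← Units.val_mul, mul_inv_cancel, Units.val_one,
      Matrix.one_mulVec]

/-- The matrix over `F` with the given entries `0` and `1`. -/
def bitMatrix (F : Type*) [Field F] {d r : ℕ} (A : Matrix (Fin d) (Fin r) Bool) :
    Matrix (Fin d) (Fin r) F :=
  A.map fun b => if b then 1 else 0

/-- The column space of a matrix of zeros and ones. -/
def im (F : Type*) [Field F] {d r : ℕ} (A : Matrix (Fin d) (Fin r) Bool) :
    Submodule F (Fin d → F) :=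
  LinearMap.range (bitMatrix F A).mulVecLin

/-- The action `(g, π) • (x i)ᵢ = (g • x (π⁻¹ i))ᵢ` on `n`-tuples of subspaces of `F ^ d`. -/
def act {d n : ℕ} (g : Matrix.GeneralLinearGroup (Fin d) F) (π : Equiv.Perm (Fin n))
    (x : Fin n → Submodule F (Fin d → F)) : Fin n → Submodule F (Fin d → F) :=
  fun i => (x (π⁻¹ i)).map (g : Matrix (Fin d) (Fin d) F).mulVecLin

/-- `x` and `y` lie in a common orbit of the action of `Γ × S_n`. -/
def CommonOrbit {d n : ℕ} (Γ : Subgroup (Matrix.GeneralLinearGroup (Fin d) F))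
    (x y : Fin n → Submodule F (Fin d → F)) : Prop :=
  ∃ g ∈ Γ, ∃ π : Equiv.Perm (Fin n), act g π x = y

end Subspaces

/-- `Q(r, d, n, F)`: the pairs of `n`-tuples of `d × r` matrices of zeros and ones
that have rank `r` over `F`. -/
structure TuplePair (r d n : ℕ) (F : Type*) [Field F] where
  /-- the first tuple -/
  A : Fin n → Matrix (Fin d) (Fin r) Bool
  /-- the second tuple -/
  B : Fin n → Matrix (Fin d) (Fin r) Bool
  rank_A : ∀ i, (bitMatrix F (A i)).rank = r
  rank_B : ∀ i, (bitMatrix F (B i)).rank = r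

/-- The instances of `problemU r F σ`: the union of `Q(r, d, n, F)` over `d, n ≥ 1`. -/
structure InstU (r : ℕ) (F : Type*) [Field F] where
  d : ℕ
  n : ℕ
  d_pos : 1 ≤ d
  n_pos : 1 ≤ n
  pair : TuplePair r d n F

/-- The instances of `problemGL F`: the union of `Q(r, d, n, F)` over `r, d, n ≥ 1`. -/
structure InstGL (F : Type*) [Field F] where
  r : ℕ
  d : ℕ
  n : ℕ
  r_pos : 1 ≤ r
  d_pos : 1 ≤ d
  n_pos : 1 ≤ n
  pair : TuplePair r d n F

/-- Isomorphism up to `U(d, F, σ)` and permutation, for tuples of subspaces of fixed dimension `r`.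
An instance is represented by `d`, `n`, followed by the `2rdn` bits of the matrices. -/
def problemU (r : ℕ) (F : Type*) [Field F] (σ : F ≃+* F) : DecisionProblem where
  Inst := InstU r F
  yes x := CommonOrbit (unitary x.d σ) (fun i => im F (x.pair.A i)) (fun i => im F (x.pair.B i))
  size x := 2 * r * x.d * x.n
  holds m x := m 0 = x.d ∧ m 1 = x.n ∧
    HoldsBits m 2 x.pair.A ∧ HoldsBits m (2 + x.n * x.d * r) x.pair.B
  holds_unique := by
    rintro m ⟨d, n, hd, hn, ⟨A, B, hA, hB⟩⟩ ⟨d', n', hd', hn', ⟨A', B', hA', hB'⟩⟩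
      ⟨h0, h1, h2, h3⟩ ⟨h0', h1', h2', h3'⟩
    dsimp only at h0 h1 h0' h1'
    obtain rfl : d = d' := h0.symm.trans h0'
    obtain rfl : n = n' := h1.symm.trans h1'
    obtain rfl : A = A' := h2.unique h2'
    obtain rfl : B = B' := h3.unique h3'
    rfl
  holds_exists x := by
    obtain ⟨m, h, hA, hB⟩ := exists_memory (fun k => if k = 0 then x.d else x.n) 2
      x.pair.A x.pair.B
    exact ⟨m, by simpa using h 0 (by simp), by simpa using h 1 (by simp), hA, hB⟩

/-- Isomorphism up to `GL(d, F)` and permutation, for tuples of subspaces of equal dimension, which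
is part of the instance. An instance is represented by `r`, `d`, `n`, followed by the `2rdn` bits of
the matrices. -/
def problemGL (F : Type*) [Field F] : DecisionProblem where
  Inst := InstGL F
  yes x := CommonOrbit (⊤ : Subgroup (Matrix.GeneralLinearGroup (Fin x.d) F))
    (fun i => im F (x.pair.A i)) (fun i => im F (x.pair.B i))
  size x := 2 * x.r * x.d * x.n
  holds m x := m 0 = x.r ∧ m 1 = x.d ∧ m 2 = x.n ∧
    HoldsBits m 3 x.pair.A ∧ HoldsBits m (3 + x.n * x.d * x.r) x.pair.B
  holds_unique := by
    rintro m ⟨r, d, n, hr, hd, hn, ⟨A, B, hA, hB⟩⟩ ⟨r', d', n', hr', hd', hn', ⟨A', B', hA', hB'⟩⟩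
      ⟨h0, h1, h2, h3, h4⟩ ⟨h0', h1', h2', h3', h4'⟩
    dsimp only at h0 h1 h2 h0' h1' h2'
    obtain rfl : r = r' := h0.symm.trans h0'
    obtain rfl : d = d' := h1.symm.trans h1'
    obtain rfl : n = n' := h2.symm.trans h2'
    obtain rfl : A = A' := h3.unique h3'
    obtain rfl : B = B' := h4.unique h4'
    rfl
  holds_exists x := by
    obtain ⟨m, h, hA, hB⟩ := exists_memory
      (fun k => if k = 0 then x.r else if k = 1 then x.d else x.n) 3 x.pair.A x.pair.B
    exact ⟨m, by simpa using h 0 (by simp), by simpa using h 1 (by simp),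
      by simpa using h 2 (by simp), hA, hB⟩

end SubspaceIso

namespace SubspaceIso

/-! ## The subspaces attached to a set system -/

section Padding

variable {F : Type*} [Field F] {ρ n : ℕ}

/-! The reduction asks one query. Put `ρ = r - 1` and encode a set `S ⊆ [n]` by the subspace `W_S =
F^ρ ⊕ F·1_S` of `F^(ρ+n)`. It is the image of a 0/1 matrix, of dimension `r` when `S` is nonempty. A
graph becomes the tuple of all `W_{v}`, each listed twice, and all `W_{u,v}` for edges `uv`.

A graph isomorphism acts on these tuples by a permutation matrix, which preserves the form for every
`σ`. Conversely, suppose an invertible `γ` and a permutation `π` match two such tuples. Then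
equalities of subspaces and inclusions in sums are preserved. A nonempty `S` can be recovered from
`W_S` (`im_padded_injective`), so the repeated members are exactly those of the vertices. Hence `π`
sends vertices to vertices and induces an injection `φ` on them. Since `1_{u,v} = 1_u + 1_v`, the
space of an edge lies in `W_u + W_v`. So the image edge is contained in `{φ u, φ v}`
(`eq_or_eq_of_im_padded_le`), and having two elements it equals that set. This is `iso_of_perm`. The
form plays no role in this direction, so `commonOrbit_iff` holds for any group containing the
permutation matrices, over any field; part (b) uses it with `r = 1`.

For the machine, the target memory is a fixed function `m`, and each program fragment is shown to
extend the prefix on which the output array agrees with `m`, within an explicit time. Both problems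
differ only in the header, which `Encodes` abstracts; `giHard_of_encodes` assembles the polynomial
bound. -/

/-- The block matrix with an identity block of size `ρ` and the indicator of `S` as last column. -/
def padded (ρ : ℕ) {n : ℕ} (S : Fin n → Bool) : Matrix (Fin (ρ + n)) (Fin (ρ + 1)) Bool :=
  fun a b => Fin.addCases (fun a' => decide (a'.1 = b.1)) (fun v => decide (b.1 = ρ) && S v) a

theorem padded_mulVec_castAdd (S : Fin n → Bool) (z : Fin (ρ + 1) → F) (a : Fin ρ) :
    (bitMatrix F (padded ρ S)).mulVec z (Fin.castAdd n a) = z a.castSucc := by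
  rw [Matrix.mulVec, dotProduct, Finset.sum_eq_single a.castSucc]
  · simp [bitMatrix, padded]
  · intro b _ hb
    have : ¬ (a.1 = b.1) := fun h => hb (Fin.ext h.symm)
    simp [bitMatrix, padded, this]
  · simp

theorem padded_mulVec_natAdd (S : Fin n → Bool) (z : Fin (ρ + 1) → F) (v : Fin n) :
    (bitMatrix F (padded ρ S)).mulVec z (Fin.natAdd ρ v) = if S v then z (Fin.last ρ) else 0 := by
  rw [Matrix.mulVec, dotProduct, Finset.sum_eq_single (Fin.last ρ)]
  · simp [bitMatrix, padded]
  · intro b _ hb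
    have : ¬ (b.1 = ρ) := fun h => hb (Fin.ext h)
    simp [bitMatrix, padded, this]
  · simp

/-- The identity block makes the first `ρ` coordinates arbitrary, so only the last `n` are
constrained. All later arguments use this description instead of the matrices. -/
theorem mem_im_padded {S : Fin n → Bool} {x : Fin (ρ + n) → F} :
    x ∈ im F (padded ρ S) ↔ ∃ c : F, ∀ v, x (Fin.natAdd ρ v) = if S v then c else 0 := by
  constructor
  · rintro ⟨z, rfl⟩
    exact ⟨z (Fin.last ρ), fun v => padded_mulVec_natAdd S z v⟩
  · rintro ⟨c, hc⟩
    refine ⟨Fin.snoc (fun a => x (Fin.castAdd n a)) c, funext fun a => ?_⟩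
    rw [Matrix.mulVecLin_apply]
    refine Fin.addCases (fun a => ?_) (fun v => ?_) a
    · rw [padded_mulVec_castAdd, Fin.snoc_castSucc]
    · rw [padded_mulVec_natAdd, Fin.snoc_last, hc]

theorem rank_padded {S : Fin n → Bool} (hS : ∃ v, S v = true) :
    (bitMatrix F (padded ρ S)).rank = ρ + 1 := by
  obtain ⟨v, hv⟩ := hS
  have hinj : Function.Injective (bitMatrix F (padded ρ S)).mulVecLin := by
    intro z z' h
    funext b
    refine Fin.lastCases ?_ (fun a => ?_) b
    · have := congrFun h (Fin.natAdd ρ v)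
      simpa [padded_mulVec_natAdd, hv] using this
    · have := congrFun h (Fin.castAdd n a)
      simpa [padded_mulVec_castAdd] using this
  rw [Matrix.rank, LinearMap.finrank_range_of_inj hinj]
  simp

/-- The indicator vector of `S`. -/
def indicatorVec (F : Type*) [Field F] (ρ : ℕ) {n : ℕ} (S : Fin n → Bool) : Fin (ρ + n) → F :=
  Fin.addCases (fun _ => 0) (fun v => if S v then 1 else 0)

theorem indicatorVec_mem (S : Fin n → Bool) : indicatorVec F ρ S ∈ im F (padded ρ S) :=
  mem_im_padded.2 ⟨1, fun v => by simp [indicatorVec]⟩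

/-- Modulo the free coordinates both spaces are lines, so `1_S = c • 1_S'`; as `S` is nonempty, `c ≠
0` and the supports agree. -/
theorem im_padded_injective {S S' : Fin n → Bool} (hS : ∃ v, S v = true)
    (h : im F (padded ρ S) = im F (padded ρ S')) : S = S' := by
  have hmem := indicatorVec_mem (F := F) (ρ := ρ) S
  rw [h] at hmem
  obtain ⟨c, hc⟩ := mem_im_padded.1 hmem
  simp only [indicatorVec, Fin.addCases_right] at hc
  obtain ⟨w, hw⟩ := hS
  have hc0 : c ≠ 0 := by
    rintro rfl
    simpa [hw] using hc w
  funext v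
  have := hc v
  cases h1 : S v <;> cases h2 : S' v <;> simp_all

/-- The subspaces of singletons `{a}` and `{b}` together contain the subspace of `S` only if `S` is
contained in `{a, b}`. -/
theorem eq_or_eq_of_im_padded_le {S A B : Fin n → Bool}
    (h : im F (padded ρ S) ≤ im F (padded ρ A) ⊔ im F (padded ρ B)) {v : Fin n}
    (hv : S v = true) : A v = true ∨ B v = true := by
  obtain ⟨x, hx, y, hy, hxy⟩ := Submodule.mem_sup.1 (h (indicatorVec_mem S))
  obtain ⟨c, hc⟩ := mem_im_padded.1 hx
  obtain ⟨c', hc'⟩ := mem_im_padded.1 hy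
  have := congrFun hxy (Fin.natAdd ρ v)
  simp only [Pi.add_apply, hc, hc', indicatorVec, Fin.addCases_right, hv] at this
  by_contra! hcon
  simp [hcon] at this

/-- For disjoint sets `1_(A ∪ B) = 1_A + 1_B` in every characteristic; the free coordinates are put
into the first summand. -/
theorem im_padded_le_sup {S A B : Fin n → Bool} (hAB : ∀ v, ¬ (A v = true ∧ B v = true))
    (hS : ∀ v, S v = (A v || B v)) :
    im F (padded ρ S) ≤ im F (padded ρ A) ⊔ im F (padded ρ B) := by
  intro x hx
  obtain ⟨c, hc⟩ := mem_im_padded.1 hx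
  refine Submodule.mem_sup.2
    ⟨Fin.addCases (fun a => x (Fin.castAdd n a)) (fun v => if A v then c else 0),
      mem_im_padded.2 ⟨c, fun v => by simp⟩,
      Fin.addCases (fun _ => 0) (fun v => if B v then c else 0),
      mem_im_padded.2 ⟨c, fun v => by simp⟩, funext fun a => ?_⟩
  refine Fin.addCases (fun a => ?_) (fun v => ?_) a
  · simp
  · have h := hAB v
    simp only [Pi.add_apply, Fin.addCases_right, hc, hS]
    revert h
    generalize A v = p
    generalize B v = q
    cases p <;> cases q <;> simp

/-! ### Permutation matrices acting on the encoded subspaces -/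

/-- The invertible matrix of a permutation of the coordinates. -/
def permGL (F : Type*) [Field F] {d : ℕ} (τ : Equiv.Perm (Fin d)) :
    Matrix.GeneralLinearGroup (Fin d) F where
  val := τ.permMatrix F
  inv := τ⁻¹.permMatrix F
  val_inv := by rw [← Matrix.permMatrix_mul, inv_mul_cancel, Matrix.permMatrix_one]
  inv_val := by rw [← Matrix.permMatrix_mul, mul_inv_cancel, Matrix.permMatrix_one]

theorem permGL_mulVec {d : ℕ} (τ : Equiv.Perm (Fin d)) (x : Fin d → F) :
    (permGL F τ : Matrix (Fin d) (Fin d) F).mulVec x = x ∘ τ :=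
  Matrix.permMatrix_mulVec τ

/-- Permuting coordinates only reorders the sum defining the form, whatever `σ` is. -/
theorem permGL_mem_unitary {d : ℕ} (σ : F ≃+* F) (τ : Equiv.Perm (Fin d)) :
    permGL F τ ∈ unitary d σ := by
  intro x y
  rw [permGL_mulVec, permGL_mulVec]
  exact Equiv.sum_comp τ fun i => σ (x i) * y i

/-- A permutation of the last `n` among `ρ + n` coordinates. -/
def extendPerm (ρ : ℕ) {n : ℕ} (f : Equiv.Perm (Fin n)) : Equiv.Perm (Fin (ρ + n)) :=
  finSumFinEquiv.permCongr (Equiv.sumCongr (Equiv.refl (Fin ρ)) f)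

theorem extendPerm_natAdd (f : Equiv.Perm (Fin n)) (v : Fin n) :
    extendPerm ρ f (Fin.natAdd ρ v) = Fin.natAdd ρ (f v) := by
  simp [extendPerm, Equiv.permCongr_apply]

theorem map_permGL_im (f : Equiv.Perm (Fin n)) (S : Fin n → Bool) :
    (im F (padded ρ S)).map
      (permGL F (extendPerm ρ f) : Matrix (Fin (ρ + n)) (Fin (ρ + n)) F).mulVecLin =
      im F (padded ρ (S ∘ f)) := by
  ext y
  constructor
  · rintro ⟨x, hx, rfl⟩
    obtain ⟨c, hc⟩ := mem_im_padded.1 hx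
    refine mem_im_padded.2 ⟨c, fun v => ?_⟩
    rw [Matrix.mulVecLin_apply, permGL_mulVec, Function.comp_apply, extendPerm_natAdd, hc]
    rfl
  · intro hy
    obtain ⟨c, hc⟩ := mem_im_padded.1 hy
    refine ⟨y ∘ (extendPerm ρ f).symm, mem_im_padded.2 ⟨c, fun v => ?_⟩, ?_⟩
    · have h : (extendPerm ρ f).symm (Fin.natAdd ρ v) = Fin.natAdd ρ (f.symm v) := by
        rw [Equiv.symm_apply_eq, extendPerm_natAdd, Equiv.apply_symm_apply]
      rw [Function.comp_apply, h, hc]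
      simp
    · rw [Matrix.mulVecLin_apply, permGL_mulVec]
      funext a
      simp

end Padding

/-! ## The set system of a graph -/

section Graph

variable {n e : ℕ} {g g' : SimpleGraph (Fin n)}

/-- The indices of the set system of a graph: every vertex twice, every edge once. -/
def blockEquiv (n e : ℕ) : (Fin n ⊕ Fin n) ⊕ Fin e ≃ Fin (n + n + e) :=
  (Equiv.sumCongr finSumFinEquiv (Equiv.refl (Fin e))).trans finSumFinEquiv

/-- The indicators of the vertices (twice) and of the edges of a graph. -/
def system (g : SimpleGraph (Fin n)) (l : Fin e ≃ g.edgeSet) :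
    (Fin n ⊕ Fin n) ⊕ Fin e → Fin n → Bool
  | .inl (.inl v) => fun w => decide (w = v)
  | .inl (.inr v) => fun w => decide (w = v)
  | .inr i => (LabelledGraph.mk n e g l).inc.col i

theorem system_edge (l : Fin e ≃ g.edgeSet) (i : Fin e) (v : Fin n) :
    system g l (.inr i) v = true ↔ v ∈ (l i : Sym2 (Fin n)) := by
  simp [system, LabelledGraph.inc, Matrix.col]

theorem system_nonempty (l : Fin e ≃ g.edgeSet) (k : (Fin n ⊕ Fin n) ⊕ Fin e) :
    ∃ v, system g l k v = true := by
  rcases k with (v | v) | i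
  · exact ⟨v, by simp [system]⟩
  · exact ⟨v, by simp [system]⟩
  · exact ⟨_, (system_edge l i _).2 (Sym2.out_fst_mem (l i : Sym2 (Fin n)))⟩

theorem exists_edge_eq (l : Fin e ≃ g.edgeSet) (i : Fin e) :
    ∃ u v, g.Adj u v ∧ (l i : Sym2 (Fin n)) = s(u, v) := by
  obtain ⟨z, hz⟩ := l i
  induction z using Sym2.ind with
  | _ u v => exact ⟨u, v, hz, rfl⟩

/-- The vertices are the indices whose indicator is repeated. -/
theorem isLeft_iff_repeated (l : Fin e ≃ g.edgeSet) (k : (Fin n ⊕ Fin n) ⊕ Fin e) :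
    k.isLeft = true ↔ ∃ k', k' ≠ k ∧ system g l k' = system g l k := by
  -- An edge set has two distinct elements, so it is no singleton, and distinct labels carry
  -- distinct edges.
  have hedge : ∀ (i : Fin e) (k'), k' ≠ .inr i → system g l k' ≠ system g l (.inr i) := by
    intro i k' hk' h
    have hmem : ∀ w, system g l k' w = true ↔ w ∈ (l i : Sym2 (Fin n)) := fun w => by
      rw [h, system_edge]
    rcases k' with (v | v) | j
    · obtain ⟨a, b, hab, hl⟩ := exists_edge_eq l i
      simp only [system, decide_eq_true_eq, hl, Sym2.mem_iff] at hmem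
      exact hab.ne (((hmem a).2 (Or.inl rfl)).trans ((hmem b).2 (Or.inr rfl)).symm)
    · obtain ⟨a, b, hab, hl⟩ := exists_edge_eq l i
      simp only [system, decide_eq_true_eq, hl, Sym2.mem_iff] at hmem
      exact hab.ne (((hmem a).2 (Or.inl rfl)).trans ((hmem b).2 (Or.inr rfl)).symm)
    · simp only [system_edge] at hmem
      exact hk' (congrArg Sum.inr (l.injective (Subtype.ext (Sym2.ext hmem))))
  rcases k with (v | v) | i
  · exact ⟨fun _ => ⟨.inl (.inr v), by simp, rfl⟩, fun _ => rfl⟩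
  · exact ⟨fun _ => ⟨.inl (.inl v), by simp, rfl⟩, fun _ => rfl⟩
  · refine ⟨fun h => by simp at h, ?_⟩
    rintro ⟨k', h1, h2⟩
    exact absurd h2 (hedge i k' h1)

theorem exists_vertex_of_isLeft (l : Fin e ≃ g.edgeSet) {k : (Fin n ⊕ Fin n) ⊕ Fin e}
    (hk : k.isLeft = true) : ∃ v, system g l k = fun w => decide (w = v) := by
  rcases k with (v | v) | i
  · exact ⟨v, rfl⟩
  · exact ⟨v, rfl⟩
  · simp at hk

theorem exists_edge_of_not_isLeft {k : (Fin n ⊕ Fin n) ⊕ Fin e} (hk : ¬ k.isLeft = true) :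
    ∃ i, k = .inr i := by
  rcases k with k | i
  · simp at hk
  · exact ⟨i, rfl⟩

/-- An isomorphism of graphs permutes the set systems. -/
theorem exists_perm_of_iso (l : Fin e ≃ g.edgeSet) (l' : Fin e ≃ g'.edgeSet) (f : g ≃g g') :
    ∃ π : Equiv.Perm ((Fin n ⊕ Fin n) ⊕ Fin e), ∀ k v,
      system g' l' (π k) (f v) = system g l k v := by
  refine ⟨Equiv.sumCongr (Equiv.sumCongr f.toEquiv f.toEquiv)
    (l.trans (f.mapEdgeSet.trans l'.symm)), ?_⟩
  rintro ((u | u) | i) v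
  · simp [system]
  · simp [system]
  · rw [Bool.eq_iff_iff]
    simp only [Equiv.sumCongr_apply, Sum.map_inr, system_edge, Equiv.trans_apply,
      Equiv.apply_symm_apply]
    obtain ⟨a, b, hab, hl⟩ := exists_edge_eq l i
    have : ((f.mapEdgeSet (l i) : g'.edgeSet) : Sym2 (Fin n)) = s(f a, f b) := by
      simp [SimpleGraph.Iso.mapEdgeSet, SimpleGraph.Hom.mapEdgeSet, hl]
    rw [this, hl]
    simp

/-- A bijection between the set systems of two graphs which respects equality of sets, and
the inclusions of edges in pairs of vertices, comes from an isomorphism. -/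
theorem iso_of_perm (l : Fin e ≃ g.edgeSet) (l' : Fin e ≃ g'.edgeSet)
    (π : Equiv.Perm ((Fin n ⊕ Fin n) ⊕ Fin e))
    (heq : ∀ k k', system g l k = system g l k' ↔ system g' l' (π k) = system g' l' (π k'))
    (hle : ∀ i u v, (l i : Sym2 (Fin n)) = s(u, v) → ∀ w, system g' l' (π (.inr i)) w = true →
      system g' l' (π (.inl (.inl u))) w = true ∨ system g' l' (π (.inl (.inl v))) w = true) :
    Nonempty (g ≃g g') := by
  have hleft : ∀ k, (π k).isLeft = true ↔ k.isLeft = true := by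
    intro k
    rw [isLeft_iff_repeated l', isLeft_iff_repeated l]
    constructor
    · rintro ⟨k', h1, h2⟩
      refine ⟨π.symm k', fun h => h1 (by rw [← h, Equiv.apply_symm_apply]), ?_⟩
      rw [heq, Equiv.apply_symm_apply, h2]
    · rintro ⟨k', h1, h2⟩
      exact ⟨π k', fun h => h1 (π.injective h), (heq _ _).1 h2⟩
  -- `π` may send the two copies of a vertex to any copies; reading off the first copy suffices to
  -- define `φ`.
  have hφ : ∀ v, ∃ w, system g' l' (π (.inl (.inl v))) = fun x => decide (x = w) := fun v =>
    exists_vertex_of_isLeft l' ((hleft _).2 rfl)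
  choose φ hφ using hφ
  have hinj : Function.Injective φ := by
    intro u v h
    have h1 : system g' l' (π (.inl (.inl u))) = system g' l' (π (.inl (.inl v))) := by
      rw [hφ, hφ, h]
    have h2 := congrFun ((heq _ _).2 h1) u
    simpa [system] using h2
  have hmap : ∀ i j, π (.inr i) = .inr j → ∀ u v, (l i : Sym2 (Fin n)) = s(u, v) →
      (l' j : Sym2 (Fin n)) = s(φ u, φ v) := by
    intro i j hij u v huv
    obtain ⟨a, b, hab, hl⟩ := exists_edge_eq l' j
    have h := hle i u v huv
    simp only [hij, system_edge, hl, hφ, decide_eq_true_eq, Sym2.mem_iff] at h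
    have ha := h a (Or.inl rfl)
    have hb := h b (Or.inr rfl)
    rw [hl, Sym2.eq_iff]
    have := hab.ne
    -- Two distinct elements `a`, `b` of `{φ u, φ v}` exhaust it.
    grind
  have hadj : ∀ u v, g'.Adj (φ u) (φ v) ↔ g.Adj u v := by
    intro u v
    constructor
    · intro h
      obtain ⟨j, hj⟩ := l'.surjective ⟨s(φ u, φ v), h⟩
      have hk : ¬ (π.symm (.inr j)).isLeft = true := by
        rw [← hleft, Equiv.apply_symm_apply]
        simp
      obtain ⟨i, hi⟩ := exists_edge_of_not_isLeft hk
      obtain ⟨a, b, hab, hl⟩ := exists_edge_eq l i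
      have h1 := hmap i j (by rw [← hi, Equiv.apply_symm_apply]) a b hl
      rw [hj, Sym2.eq_iff] at h1
      rcases h1 with ⟨h1, h2⟩ | ⟨h1, h2⟩
      · rwa [hinj h1, hinj h2]
      · rw [hinj h1, hinj h2]
        exact hab.symm
    · intro h
      obtain ⟨i, hi⟩ := l.surjective ⟨s(u, v), h⟩
      have hk : ¬ (π (.inr i)).isLeft = true := by
        rw [hleft]
        simp
      obtain ⟨j, hj⟩ := exists_edge_of_not_isLeft hk
      have h1 := hmap i j hj u v (by rw [hi])
      have h2 := (l' j).2
      rw [h1] at h2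
      exact h2
  exact ⟨⟨Equiv.ofBijective φ (Finite.injective_iff_bijective.1 hinj), hadj _ _⟩⟩

end Graph

/-! ## The reduction -/

section Reduction

variable {F : Type*} [Field F] {ρ n e : ℕ} {g g' : SimpleGraph (Fin n)}

/-- The tuple of matrices attached to a graph. -/
def tuple (ρ : ℕ) (g : SimpleGraph (Fin n)) (l : Fin e ≃ g.edgeSet) :
    Fin (n + n + e) → Matrix (Fin (ρ + n)) (Fin (ρ + 1)) Bool :=
  fun i => padded ρ (system g l ((blockEquiv n e).symm i))

theorem commonOrbit_of_iso {Γ : Subgroup (Matrix.GeneralLinearGroup (Fin (ρ + n)) F)}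
    (hΓ : ∀ τ, permGL F τ ∈ Γ) (l : Fin e ≃ g.edgeSet) (l' : Fin e ≃ g'.edgeSet) (f : g ≃g g') :
    CommonOrbit Γ (fun i => im F (tuple ρ g l i)) (fun i => im F (tuple ρ g' l' i)) := by
  obtain ⟨π, hπ⟩ := exists_perm_of_iso l l' f
  -- Permutation matrices act by precomposition, hence the inverse of `f`.
  refine ⟨permGL F (extendPerm ρ f.toEquiv.symm), hΓ _, (blockEquiv n e).permCongr π,
    funext fun i => ?_⟩
  obtain ⟨k, rfl⟩ := ((π.trans (blockEquiv n e)).surjective i)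
  have h : ((blockEquiv n e).permCongr π)⁻¹ (blockEquiv n e (π k)) = blockEquiv n e k := by
    rw [Equiv.Perm.inv_eq_iff_eq]
    simp [Equiv.permCongr_apply]
  simp only [act, tuple, Equiv.trans_apply, h, Equiv.symm_apply_apply, map_permGL_im]
  congr 2
  funext v
  have := hπ k (f.symm v)
  simp only [RelIso.apply_symm_apply] at this
  rw [this]
  rfl

/-- Of the group element only injectivity is used: it preserves and reflects equality of subspaces
and carries sums to sums. -/
theorem iso_of_commonOrbit {Γ : Subgroup (Matrix.GeneralLinearGroup (Fin (ρ + n)) F)}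
    (l : Fin e ≃ g.edgeSet) (l' : Fin e ≃ g'.edgeSet)
    (h : CommonOrbit Γ (fun i => im F (tuple ρ g l i)) (fun i => im F (tuple ρ g' l' i))) :
    Nonempty (g ≃g g') := by
  obtain ⟨γ, -, π, h⟩ := h
  set M := (γ : Matrix (Fin (ρ + n)) (Fin (ρ + n)) F).mulVecLin
  have hM : Function.Injective M :=
    Matrix.mulVec_injective_of_isUnit γ.isUnit
  set κ := (blockEquiv n e).symm.permCongr π
  have hmap : ∀ k, im F (padded ρ (system g' l' (κ k))) =
      (im F (padded ρ (system g l k))).map M := by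
    intro k
    have h1 := congrFun h (π (blockEquiv n e k))
    have h2 : π⁻¹ (π (blockEquiv n e k)) = blockEquiv n e k := π.symm_apply_apply _
    simp only [act, tuple, h2, Equiv.symm_apply_apply] at h1
    simp only [M, h1, κ, Equiv.permCongr_apply, Equiv.symm_symm]
  refine iso_of_perm l l' κ (fun k k' => ⟨fun hk => ?_, fun hk => ?_⟩) ?_
  · refine im_padded_injective (F := F) (ρ := ρ) (system_nonempty l' _) ?_
    rw [hmap, hmap, hk]
  · refine im_padded_injective (F := F) (ρ := ρ) (system_nonempty l _) ?_
    refine Submodule.map_injective_of_injective hM ?_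
    rw [← hmap, ← hmap, hk]
  · intro i u v huv w hw
    refine eq_or_eq_of_im_padded_le (F := F) (ρ := ρ) ?_ hw
    rw [hmap, hmap, hmap, ← Submodule.map_sup]
    refine Submodule.map_mono (im_padded_le_sup (fun x => ?_) fun x => ?_)
    · have hne : u ≠ v := by
        rintro rfl
        have := (l i).2
        rw [huv] at this
        exact g.loopless.irrefl _ this
      simp only [system, decide_eq_true_eq]
      rintro ⟨rfl, h2⟩
      exact hne h2
    · rw [Bool.eq_iff_iff, system_edge, huv]
      simp [system]

theorem commonOrbit_iff {Γ : Subgroup (Matrix.GeneralLinearGroup (Fin (ρ + n)) F)}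
    (hΓ : ∀ τ, permGL F τ ∈ Γ) (l : Fin e ≃ g.edgeSet) (l' : Fin e ≃ g'.edgeSet) :
    CommonOrbit Γ (fun i => im F (tuple ρ g l i)) (fun i => im F (tuple ρ g' l' i)) ↔
      Nonempty (g ≃g g') :=
  ⟨iso_of_commonOrbit l l', fun ⟨f⟩ => commonOrbit_of_iso hΓ l l' f⟩

/-- The instance attached to a pair of graphs. -/
def graphPair (ρ : ℕ) (F : Type*) [Field F] (l : Fin e ≃ g.edgeSet) (l' : Fin e ≃ g'.edgeSet) :
    TuplePair (ρ + 1) (ρ + n) (n + n + e) F where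
  A := tuple ρ g l
  B := tuple ρ g' l'
  rank_A _ := rank_padded (system_nonempty l _)
  rank_B _ := rank_padded (system_nonempty l' _)

end Reduction

end SubspaceIso

namespace SubspaceIso

/-! ## A calculus of programs with time bounds -/

section Calculus

variable {P : DecisionProblem} {time : P.Inst → ℕ}

@[simp] theorem State.setReg_reg (s : State) (x v y : ℕ) :
    (s.setReg x v).reg y = if y = x then v else s.reg y := by
  simp [State.setReg, Function.update_apply]

@[simp] theorem State.setReg_arr (s : State) (x v : ℕ) : (s.setReg x v).arr = s.arr := rfl

@[simp] theorem State.setArr_reg (s : State) (a i v : ℕ) : (s.setArr a i v).reg = s.reg := rfl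

theorem State.setArr_arr_self (s : State) (a i v k : ℕ) :
    (s.setArr a i v).arr a k = if k = i then v else s.arr a k := by
  simp [State.setArr, Function.update_apply]

theorem State.setArr_arr_of_ne (s : State) {a b : ℕ} (i v : ℕ) (h : b ≠ a) :
    (s.setArr a i v).arr b = s.arr b := by
  simp [State.setArr, h]

/-- Started in the state `s`, the program `c` halts within time `T` in a state satisfying `Q`. -/
def HaltsWithin (P : DecisionProblem) (time : P.Inst → ℕ) (c : Prog) (T : ℕ) (Q : State → Prop)
    (s : State) : Prop :=
  ∃ t s', Exec P time c s t s' ∧ t ≤ T ∧ Q s'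

namespace HaltsWithin

variable {c c' : Prog} {s : State} {T T' : ℕ} {Q Q' : State → Prop}

theorem mono (h : HaltsWithin P time c T Q s) (hT : T ≤ T') (hQ : ∀ s', Q s' → Q' s') :
    HaltsWithin P time c T' Q' s := by
  obtain ⟨t, s', h1, h2, h3⟩ := h
  exact ⟨t, s', h1, h2.trans hT, hQ _ h3⟩

theorem seq (h : HaltsWithin P time c T (fun s' => HaltsWithin P time c' T' Q s') s) :
    HaltsWithin P time (.seq c c') (T + T') Q s := by
  obtain ⟨t, s', h1, h2, t', s'', h3, h4, h5⟩ := h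
  exact ⟨t + t', s'', .seq h1 h3, Nat.add_le_add h2 h4, h5⟩

theorem seq_of (h : HaltsWithin P time c T Q' s)
    (h' : ∀ s', Q' s' → HaltsWithin P time c' T' Q s') :
    HaltsWithin P time (.seq c c') (T + T') Q s :=
  seq (h.mono le_rfl h')

theorem skip (h : Q s) : HaltsWithin P time .skip 1 Q s := ⟨1, s, .skip s, le_rfl, h⟩

theorem const {x k : ℕ} (h : Q (s.setReg x k)) : HaltsWithin P time (.const x k) 1 Q s :=
  ⟨1, _, .const s x k, le_rfl, h⟩

theorem add {x y z : ℕ} (h : Q (s.setReg x (s.reg y + s.reg z))) :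
    HaltsWithin P time (.add x y z) 1 Q s :=
  ⟨1, _, .add s x y z, le_rfl, h⟩

theorem sub {x y z : ℕ} (h : Q (s.setReg x (s.reg y - s.reg z))) :
    HaltsWithin P time (.sub x y z) 1 Q s :=
  ⟨1, _, .sub s x y z, le_rfl, h⟩

theorem read {x a y : ℕ} (h : Q (s.setReg x (s.arr a (s.reg y)))) :
    HaltsWithin P time (.read x a y) 1 Q s :=
  ⟨1, _, .read s x a y, le_rfl, h⟩

theorem write {a x y : ℕ} (h : Q (s.setArr a (s.reg x) (s.reg y))) :
    HaltsWithin P time (.write a x y) 1 Q s :=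
  ⟨1, _, .write s a x y, le_rfl, h⟩

theorem ite_nonzero {x : ℕ} (hx : s.reg x ≠ 0) (h : HaltsWithin P time c T Q s) :
    HaltsWithin P time (.ite x c c') (T + 1) Q s := by
  obtain ⟨t, s', h1, h2, h3⟩ := h
  exact ⟨t + 1, s', .ite_nonzero hx h1, Nat.add_le_add_right h2 1, h3⟩

theorem ite_zero {x : ℕ} (hx : s.reg x = 0) (h : HaltsWithin P time c' T Q s) :
    HaltsWithin P time (.ite x c c') (T + 1) Q s := by
  obtain ⟨t, s', h1, h2, h3⟩ := h
  exact ⟨t + 1, s', .ite_zero hx h1, Nat.add_le_add_right h2 1, h3⟩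

/-- A loop whose counter runs down from `N` to `0`. -/
theorem loop {x N : ℕ} (I : ℕ → State → Prop) (hx : ∀ j s, I j s → s.reg x = N - j)
    (h : ∀ j s, j < N → I j s → HaltsWithin P time c T (I (j + 1)) s) (h0 : I 0 s) :
    HaltsWithin P time (.loop x c) (N * (T + 1) + 1) (I N) s := by
  -- Induction on the number `k` of remaining rounds; each costs its body and one test, and the
  -- final `1` is the failing test.
  have key : ∀ k j s, j + k = N → I j s →
      HaltsWithin P time (.loop x c) (k * (T + 1) + 1) (I N) s := by
    intro k
    induction k with
    | zero =>
      intro j s hj hI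
      obtain rfl : j = N := hj
      exact ⟨1, s, .loop_done (by rw [hx j s hI, Nat.sub_self]), by simp, hI⟩
    | succ k ih =>
      intro j s hj hI
      obtain ⟨t, s', h1, h2, h3⟩ := h j s (by omega) hI
      obtain ⟨t', s'', h1', h2', h3'⟩ := ih (j + 1) s' (by omega) h3
      refine ⟨t + t' + 1, s'', .loop_step (by rw [hx j s hI]; omega) h1 h1', ?_, h3'⟩
      rw [Nat.succ_mul]
      omega
  exact key N 0 s (Nat.zero_add N) h0

theorem query {x a : ℕ} {w : P.Inst} (hw : P.holds (s.arr a) w)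
    (hy : P.yes w → Q (s.setReg x 1)) (hn : ¬ P.yes w → Q (s.setReg x 0)) :
    HaltsWithin P time (.query x a) (time w + 1) Q s := by
  by_cases h : P.yes w
  · exact ⟨_, _, .query_yes s x a w hw h, le_rfl, hy h⟩
  · exact ⟨_, _, .query_no s x a w hw h, le_rfl, hn h⟩

end HaltsWithin

end Calculus

/-! ## Writing the instance -/

section Writing

variable {P : DecisionProblem} {time : P.Inst → ℕ} {μ m : ℕ → ℕ} {n e p ρ : ℕ} {s : State}

/-- Registers `0` to `4` hold `0`, `1`, the numbers of vertices and edges, and the length `p` of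
the output; the input `μ` is in array `0`, and the first `p` cells of array `1` agree with `m`. -/
structure Core (μ m : ℕ → ℕ) (n e p : ℕ) (s : State) : Prop where
  zero : s.reg 0 = 0
  one : s.reg 1 = 1
  nV : s.reg 2 = n
  nE : s.reg 3 = e
  ptr : s.reg 4 = p
  input : s.arr 0 = μ
  output : ∀ k < p, s.arr 1 k = m k

/-- Registers from `5` on are scratch space. -/
theorem Core.setReg (h : Core μ m n e p s) {x : ℕ} (hx : 5 ≤ x) (v : ℕ) :
    Core μ m n e p (s.setReg x v) := by
  have hne : ∀ y < 5, y ≠ x := fun y hy => by omega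
  constructor
  · simp [hne 0, h.zero]
  · simp [hne 1, h.one]
  · simp [hne 2, h.nV]
  · simp [hne 3, h.nE]
  · simp [hne 4, h.ptr]
  · exact h.input
  · exact h.output

/-! ### Appending numbers, rows, matrices and blocks to the output -/

/-- Append the content of register `y` to the output. -/
def emit (y : ℕ) : Prog := .seq (.write 1 4 y) (.add 4 4 1)

theorem haltsWithin_emit {y : ℕ} (h : Core μ m n e p s) (hy : m p = s.reg y) :
    HaltsWithin P time (emit y) 2
      (fun s' => Core μ m n e (p + 1) s' ∧ ∀ x, x ≠ 4 → s'.reg x = s.reg x) s := by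
  refine .seq (.write (.add ⟨⟨?_, ?_, ?_, ?_, ?_, ?_, ?_⟩, ?_⟩))
  · simp [h.zero]
  · simp [h.one]
  · simp [h.nV]
  · simp [h.nE]
  · simp [h.ptr, h.one]
  · rw [State.setReg_arr, State.setArr_arr_of_ne _ _ _ (by decide), h.input]
  · intro k hk
    rw [State.setReg_arr, State.setArr_arr_self, h.ptr]
    split_ifs with hkp
    · rw [hkp, hy]
    · exact h.output k (by omega)
  · intro x hx
    simp [hx]

/-- Append the given numbers to the output. -/
def emitList : List ℕ → Prog
  | [] => .skip
  | k :: l => .seq (.const 7 k) (.seq (emit 7) (emitList l))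

theorem haltsWithin_emitList (l : List ℕ) {p : ℕ} {s : State} (h : Core μ m n e p s)
    (hl : ∀ (k : ℕ) (hk : k < l.length), m (p + k) = l[k]) :
    HaltsWithin P time (emitList l) (3 * l.length + 1)
      (fun s' => Core μ m n e (p + l.length) s' ∧ ∀ x, x ≠ 4 → x ≠ 7 → s'.reg x = s.reg x) s := by
  induction l generalizing p s with
  | nil => exact .skip ⟨h, fun _ _ _ => rfl⟩
  | cons k l ih =>
    have h0 := hl 0 (by simp)
    refine HaltsWithin.mono (T := 1 + (2 + (3 * l.length + 1))) (.seq (.const ?_))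
      (by rw [List.length_cons]; omega) fun _ => id
    refine .seq_of (haltsWithin_emit (h.setReg (by omega) k) (by simpa using h0)) ?_
    rintro s1 ⟨h1, hf1⟩
    refine (ih h1 fun j hj => ?_).mono le_rfl ?_
    · have := hl (j + 1) (by simpa using hj)
      simpa [Nat.add_assoc, Nat.add_comm 1 j] using this
    · rintro s2 ⟨h2, hf2⟩
      refine ⟨?_, fun x h4 h7 => ?_⟩
      · rw [List.length_cons, Nat.add_comm l.length 1, ← Nat.add_assoc]
        exact h2
      · rw [hf2 x h4 h7, hf1 x h4, State.setReg_reg, if_neg h7]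

/-- The rows of the identity block, one after the other. -/
def identityRows (ρ : ℕ) : List ℕ :=
  (List.range (ρ * (ρ + 1))).map fun k => if k / (ρ + 1) = k % (ρ + 1) then 1 else 0

/-- Append one row below the identity block. -/
def emitRow (ρ : ℕ) (bit : Prog) : Prog :=
  .seq bit (.seq (emitList (List.replicate ρ 0)) (.seq (emit 9) (.sub 6 6 1)))

/-- Append one matrix. -/
def emitMatrix (ρ : ℕ) (bit : Prog) : Prog :=
  .seq (emitList (identityRows ρ)) (.seq (.add 10 11 0) (.seq (.add 6 2 0)
    (.seq (.loop 6 (emitRow ρ bit)) (.seq (.add 11 11 1) (.sub 5 5 1)))))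

/-- Append as many matrices as register `cnt` says. -/
def emitBlock (ρ cnt : ℕ) (bit : Prog) : Prog :=
  .seq (.add 5 cnt 0) (.loop 5 (emitMatrix ρ bit))

/-- With the counters of `emitBlock` in registers `5` and `6`, the program `bit` computes the bit
`f i a` into register `9`. -/
def ComputesBit (P : DecisionProblem) (time : P.Inst → ℕ) (μ m : ℕ → ℕ) (n e N off : ℕ)
    (f : ℕ → ℕ → ℕ) (bit : Prog) : Prop :=
  ∀ i a p s, i < N → a < n → Core μ m n e p s → s.reg 5 = N - i → s.reg 6 = n - a →
    s.reg 10 = off + i + a * e →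
    HaltsWithin P time bit 5 (fun s' => Core μ m n e p s' ∧ s'.reg 5 = s.reg 5 ∧
      s'.reg 6 = s.reg 6 ∧ s'.reg 11 = s.reg 11 ∧ s'.reg 10 = off + i + (a + 1) * e ∧
      s'.reg 9 = f i a) s

/-- From cell `p` on, the rows `0, …, ρ - 1` of a matrix form an identity block (and a zero column),
and the other rows are zero but for the last column `f`. -/
def IsMatrixAt (m : ℕ → ℕ) (ρ n p : ℕ) (f : ℕ → ℕ) : Prop :=
  (∀ k < ρ * (ρ + 1), m (p + k) = if k / (ρ + 1) = k % (ρ + 1) then 1 else 0) ∧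
  ∀ a < n, (∀ b < ρ, m (p + ρ * (ρ + 1) + a * (ρ + 1) + b) = 0) ∧
    m (p + ρ * (ρ + 1) + a * (ρ + 1) + ρ) = f a

/-- Register `10` walks down column `i` of the row-major incidence matrix with stride `e`; register
`11` keeps the top of that column for the enclosing loops. -/
theorem haltsWithin_emitRow {N off i a : ℕ} {f : ℕ → ℕ → ℕ} {bit : Prog}
    (hbit : ComputesBit P time μ m n e N off f bit) (hi : i < N) (ha : a < n)
    (h : Core μ m n e p s) (h5 : s.reg 5 = N - i) (h6 : s.reg 6 = n - a)
    (h10 : s.reg 10 = off + i + a * e) (hz : ∀ b < ρ, m (p + b) = 0) (hl : m (p + ρ) = f i a) :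
    HaltsWithin P time (emitRow ρ bit) (3 * ρ + 9)
      (fun s' => Core μ m n e (p + (ρ + 1)) s' ∧ s'.reg 5 = N - i ∧ s'.reg 6 = n - (a + 1) ∧
        s'.reg 10 = off + i + (a + 1) * e ∧ s'.reg 11 = s.reg 11) s := by
  refine HaltsWithin.mono (T := 5 + ((3 * ρ + 1) + (2 + 1))) ?_ (by omega) fun _ => id
  refine .seq_of (hbit i a p s hi ha h h5 h6 h10) ?_
  rintro s1 ⟨c1, h15, h16, h1_11, h1_10, h19⟩
  have := haltsWithin_emitList (P := P) (time := time) (List.replicate ρ 0) c1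
    (fun k hk => by simpa using hz k (by simpa using hk))
  rw [List.length_replicate] at this
  refine .seq_of this ?_
  rintro s2 ⟨c2, f2⟩
  -- The bit was computed before the zeros were written; it survives because `emitList` touches only
  -- registers `4` and `7`.
  refine .seq_of (haltsWithin_emit (y := 9) c2 ?_) ?_
  · rw [hl, f2 9 (by decide) (by decide), h19]
  rintro s3 ⟨c3, f3⟩
  refine .sub ⟨?_, ?_, ?_, ?_, ?_⟩
  · exact c3.setReg (by decide) _
  · simp [f3, f2, h15, h5]
  · rw [State.setReg_reg, if_pos rfl, c3.one, f3 6 (by decide), f2 6 (by decide) (by decide), h16,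
      h6, Nat.sub_sub]
  · simp [f3, f2, h1_10]
  · simp [f3, f2, h1_11]

/-- A bound for the time of `emitMatrix`. -/
def matrixTime (ρ n : ℕ) : ℕ := 3 * (ρ * (ρ + 1)) + n * (3 * ρ + 10) + 6

theorem haltsWithin_emitMatrix {N off i : ℕ} {f : ℕ → ℕ → ℕ} {bit : Prog}
    (hbit : ComputesBit P time μ m n e N off f bit) (hi : i < N)
    (h : Core μ m n e p s) (h5 : s.reg 5 = N - i) (h11 : s.reg 11 = off + i)
    (hm : IsMatrixAt m ρ n p (f i)) :
    HaltsWithin P time (emitMatrix ρ bit) (matrixTime ρ n)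
      (fun s' => Core μ m n e (p + (ρ + n) * (ρ + 1)) s' ∧ s'.reg 5 = N - (i + 1) ∧
        s'.reg 11 = off + (i + 1)) s := by
  refine HaltsWithin.mono
    (T := (3 * (ρ * (ρ + 1)) + 1) + (1 + (1 + ((n * (3 * ρ + 9 + 1) + 1) + (1 + 1))))) ?_
    (by unfold matrixTime; rw [show 3 * ρ + 9 + 1 = 3 * ρ + 10 from rfl]; omega) fun _ => id
  have := haltsWithin_emitList (P := P) (time := time) (identityRows ρ) h (fun k hk => by
    simpa [identityRows] using hm.1 k (by simpa [identityRows] using hk))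
  rw [show (identityRows ρ).length = ρ * (ρ + 1) by simp [identityRows]] at this
  refine .seq_of this ?_
  rintro s1 ⟨c1, f1⟩
  refine .seq (.add (.seq (.add ?_)))
  refine .seq_of (HaltsWithin.loop (N := n)
    (fun a s' => Core μ m n e (p + ρ * (ρ + 1) + a * (ρ + 1)) s' ∧ s'.reg 5 = N - i ∧
      s'.reg 6 = n - a ∧ s'.reg 10 = off + i + a * e ∧ s'.reg 11 = off + i)
    (fun _ _ h => h.2.2.1) ?_ ?_) ?_
  · rintro a s' ha ⟨c, h5', h6', h10', h11'⟩
    refine (haltsWithin_emitRow hbit hi ha c h5' h6' h10' (hm.2 a ha).1 (hm.2 a ha).2).mono le_rfl ?_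
    rintro s'' ⟨c', h5'', h6'', h10'', h11''⟩
    exact ⟨by rwa [Nat.succ_mul, ← Nat.add_assoc], h5'', h6'', h10'', h11''.trans h11'⟩
  · refine ⟨?_, ?_, ?_, ?_, ?_⟩
    · simpa using (c1.setReg (by decide) _).setReg (by decide) _
    · simp [f1, h5]
    · simp [c1.nV, c1.zero]
    · simp [f1, h11, h.zero]
    · simp [f1, h11]
  · rintro s2 ⟨c2, h25, -, -, h2_11⟩
    refine .seq (.add (.sub ⟨?_, ?_, ?_⟩))
    · rw [Nat.add_mul, ← Nat.add_assoc]
      exact (c2.setReg (by decide) _).setReg (by decide) _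
    · simp [h25, c2.one, Nat.sub_sub]
    · simp [h2_11, c2.one, Nat.add_assoc]

/-- A bound for the time of `emitBlock`. -/
def blockTime (ρ n N : ℕ) : ℕ := N * (matrixTime ρ n + 1) + 2

theorem haltsWithin_emitBlock {N off cnt : ℕ} {f : ℕ → ℕ → ℕ} {bit : Prog}
    (hbit : ComputesBit P time μ m n e N off f bit)
    (h : Core μ m n e p s) (hcnt : s.reg cnt = N) (h11 : s.reg 11 = off)
    (hm : ∀ i < N, IsMatrixAt m ρ n (p + i * ((ρ + n) * (ρ + 1))) (f i)) :
    HaltsWithin P time (emitBlock ρ cnt bit) (blockTime ρ n N)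
      (Core μ m n e (p + N * ((ρ + n) * (ρ + 1)))) s := by
  refine HaltsWithin.mono (T := 1 + (N * (matrixTime ρ n + 1) + 1)) (.seq (.add ?_))
    (by unfold blockTime; omega) fun _ => id
  refine (HaltsWithin.loop (N := N)
    (fun i s' => Core μ m n e (p + i * ((ρ + n) * (ρ + 1))) s' ∧ s'.reg 5 = N - i ∧
      s'.reg 11 = off + i) (fun _ _ h => h.2.1) ?_ ?_).mono le_rfl fun _ h => h.1
  · rintro i s' hi ⟨c, h5', h11'⟩
    refine (haltsWithin_emitMatrix hbit hi c h5' h11' (hm i hi)).mono le_rfl ?_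
    rintro s'' ⟨c', h5'', h11''⟩
    exact ⟨by rwa [Nat.succ_mul, ← Nat.add_assoc], h5'', h11''⟩
  · exact ⟨by simpa using h.setReg (by decide) _, by simp [hcnt, h.zero], by simp [h11]⟩

/-! ### Bits of the indicators, and the tuple of a graph -/

/-- Compute the indicator of a vertex. -/
def vertexBit : Prog :=
  .seq (.sub 9 5 6) (.seq (.sub 8 6 5) (.seq (.add 9 9 8) (.seq (.sub 9 1 9) (.add 10 10 3))))

/-- The two truncated differences of the counters `n - i` and `n - a` add up to `|a - i|`, and `1`
minus this, truncated, is the bit. The address in register `10` is advanced but never read, so `off`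
is arbitrary. -/
theorem computesBit_vertexBit (off : ℕ) :
    ComputesBit P time μ m n e n off (fun i a => if a = i then 1 else 0) vertexBit := by
  intro i a p s hi ha h h5 h6 h10
  refine .seq (.sub (.seq (.sub (.seq (.add (.seq (.sub (.add ⟨?_, ?_, ?_, ?_, ?_, ?_⟩))))))))
  · exact ((((h.setReg (by decide) _).setReg (by decide) _).setReg (by decide) _).setReg
      (by decide) _).setReg (by decide) _
  · simp
  · simp
  · simp
  · simp [h10, h.nE, Nat.succ_mul, Nat.add_assoc]
  · simp only [State.setReg_reg, h5, h6, h.one]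
    norm_num
    split_ifs <;> omega

/-- Look up an entry of the incidence matrix. -/
def edgeBit : Prog := .seq (.read 9 0 10) (.add 10 10 3)

theorem computesBit_edgeBit (off : ℕ) :
    ComputesBit P time μ m n e e off (fun i a => μ (off + i + a * e)) edgeBit := by
  intro i a p s hi ha h h5 h6 h10
  refine HaltsWithin.mono (T := 1 + 1) (.seq (.read (.add ⟨?_, ?_, ?_, ?_, ?_, ?_⟩))) (by omega)
    fun _ => id
  · exact (h.setReg (by decide) _).setReg (by decide) _
  · simp
  · simp
  · simp
  · simp [h10, h.nE, Nat.succ_mul, Nat.add_assoc]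
  · simp [h10, h.input]

/-- Append the tuple of a graph, the incidence matrix of which starts at the cell computed by
`offset` into register `11`. -/
def emitGraph (ρ : ℕ) (offset : Prog) : Prog :=
  .seq (emitBlock ρ 2 vertexBit) (.seq (emitBlock ρ 2 vertexBit)
    (.seq offset (emitBlock ρ 3 edgeBit)))

/-- Cell `k` of the row-major layout has row `k / (ρ + 1)` and column `k % (ρ + 1)`. -/
theorem isMatrixAt_of_entries {p : ℕ} {S : Fin n → Bool}
    (h : ∀ (a : Fin (ρ + n)) (b : Fin (ρ + 1)), m (p + (a * (ρ + 1) + b)) = (padded ρ S a b).toNat)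
    {f : ℕ → ℕ} (hf : ∀ a : Fin n, f a = (S a).toNat) : IsMatrixAt m ρ n p f := by
  refine ⟨fun k hk => ?_, fun a ha => ⟨fun b hb => ?_, ?_⟩⟩
  · have hlt : k / (ρ + 1) < ρ := Nat.div_lt_of_lt_mul (by rwa [Nat.mul_comm])
    have := h (Fin.castAdd n ⟨k / (ρ + 1), hlt⟩) ⟨k % (ρ + 1), Nat.mod_lt _ (Nat.succ_pos ρ)⟩
    simp only [Fin.val_castAdd, padded, Fin.addCases_left, Nat.div_add_mod'] at this
    rw [this]
    split_ifs with h1 <;> simp [h1]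
  · have := h (Fin.natAdd ρ ⟨a, ha⟩) ⟨b, by omega⟩
    have hb' : b ≠ ρ := hb.ne
    simp only [Fin.val_natAdd, padded, Fin.addCases_right, hb', decide_false, Bool.false_and,
      Bool.toNat_false, Nat.add_mul, ← Nat.add_assoc] at this
    simpa only [Nat.mul_add, Nat.add_assoc] using this
  · have := h (Fin.natAdd ρ ⟨a, ha⟩) (Fin.last ρ)
    simp only [Fin.val_natAdd, padded, Fin.addCases_right, Fin.val_last, decide_true,
      Bool.true_and, Nat.add_mul, ← Nat.add_assoc, ← hf] at this
    simpa only [Nat.mul_add, Nat.add_assoc] using this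

/-- The three blocks follow the order of `blockEquiv`: indices below `n`, the next `n`, and the `e`
edges from `2n` on. -/
theorem haltsWithin_emitGraph {g : SimpleGraph (Fin n)} {l : Fin e ≃ g.edgeSet} {off T : ℕ}
    {offset : Prog} (hμ : HoldsBits μ off (fun _ : Fin 1 => (LabelledGraph.mk n e g l).inc))
    (hm : HoldsBits m p (tuple ρ g l)) (h : Core μ m n e p s)
    (hoff : ∀ p s, Core μ m n e p s →
      HaltsWithin P time offset T (fun s' => Core μ m n e p s' ∧ s'.reg 11 = off) s) :
    HaltsWithin P time (emitGraph ρ offset)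
      (blockTime ρ n n + (blockTime ρ n n + (T + blockTime ρ n e)))
      (Core μ m n e (p + (n + n + e) * (ρ + n) * (ρ + 1))) s := by
  have entries : ∀ k (a : Fin (ρ + n)) (b : Fin (ρ + 1)),
      m (p + (blockEquiv n e k).1 * ((ρ + n) * (ρ + 1)) + (a * (ρ + 1) + b)) =
        (padded ρ (system g l k) a b).toNat := by
    intro k a b
    have := hm (blockEquiv n e k) a b
    rw [tuple, Equiv.symm_apply_apply] at this
    rw [← this]
    congr 1
    ring
  -- The vertex bits do not depend on the offset, so whatever register `11` contains will do.
  refine .seq_of (haltsWithin_emitBlock (computesBit_vertexBit (s.reg 11)) h h.nV rfl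
    fun i hi => ?_) fun s1 h1 => ?_
  · refine isMatrixAt_of_entries (S := system g l (.inl (.inl ⟨i, hi⟩))) (fun a b => ?_)
      fun a => ?_
    · simpa [blockEquiv] using entries (.inl (.inl ⟨i, hi⟩)) a b
    · by_cases hai : a.1 = i <;> simp [system, Fin.ext_iff, hai]
  refine .seq_of (haltsWithin_emitBlock (computesBit_vertexBit (s1.reg 11)) h1 h1.nV rfl
    fun i hi => ?_) fun s2 h2 => ?_
  · refine isMatrixAt_of_entries (S := system g l (.inl (.inr ⟨i, hi⟩))) (fun a b => ?_)
      fun a => ?_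
    · have hk : (blockEquiv n e (.inl (.inr ⟨i, hi⟩))).1 = n + i := by simp [blockEquiv, Nat.add_comm]
      rw [← entries, hk]
      congr 1
      ring
    · by_cases hai : a.1 = i <;> simp [system, Fin.ext_iff, hai]
  refine .seq_of (hoff _ _ h2) ?_
  rintro s3 ⟨h3, h3_11⟩
  refine (haltsWithin_emitBlock (computesBit_edgeBit off) h3 h3.nE h3_11
    fun i hi => ?_).mono le_rfl fun s4 h4 => ?_
  · refine isMatrixAt_of_entries (S := system g l (.inr ⟨i, hi⟩)) (fun a b => ?_) fun a => ?_
    · have hk : (blockEquiv n e (.inr ⟨i, hi⟩)).1 = n + n + i := by simp [blockEquiv]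
      rw [← entries, hk]
      congr 1
      ring
    · have := hμ 0 a ⟨i, hi⟩
      simp only [Fin.val_zero, Nat.zero_mul, Nat.zero_add] at this
      rw [Nat.add_assoc, Nat.add_comm i]
      exact this
  · have hp : p + (n + n + e) * (ρ + n) * (ρ + 1) =
        p + n * ((ρ + n) * (ρ + 1)) + n * ((ρ + n) * (ρ + 1)) + e * ((ρ + n) * (ρ + 1)) := by ring
    rw [hp]
    exact h4

/-- Compute the position of the second incidence matrix. -/
def secondOffset : Prog :=
  .seq (.const 11 4) (.seq (.add 6 2 0) (.loop 6 (.seq (.add 11 11 3) (.sub 6 6 1))))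

/-- The product `n * e` is formed by repeated addition, as the machine cannot multiply. -/
theorem haltsWithin_secondOffset (h : Core μ m n e p s) :
    HaltsWithin P time secondOffset (3 * n + 3)
      (fun s' => Core μ m n e p s' ∧ s'.reg 11 = 4 + 1 * n * e) s := by
  refine HaltsWithin.mono (T := 1 + (1 + (n * (2 + 1) + 1))) (.seq (.const (.seq (.add ?_))))
    (by omega) fun _ => id
  refine (HaltsWithin.loop (N := n) (fun j s' => Core μ m n e p s' ∧ s'.reg 6 = n - j ∧
    s'.reg 11 = 4 + j * e) (fun _ _ h => h.2.1) ?_ ?_).mono le_rfl ?_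
  · rintro j s' hj ⟨c, h6, h11⟩
    refine .seq (.add (.sub ⟨?_, ?_, ?_⟩))
    · exact (c.setReg (by decide) _).setReg (by decide) _
    · simp [h6, c.one, Nat.sub_sub]
    · simp [h11, c.nE, Nat.succ_mul, Nat.add_assoc]
  · exact ⟨(h.setReg (by decide) _).setReg (by decide) _, by simp [h.nV, h.zero], by simp⟩
  · rintro s' ⟨c, -, h11⟩
    exact ⟨c, by rw [h11, Nat.one_mul]⟩

/-- Append the dimension and the length of the tuples to the output. -/
def emitSizes (ρ : ℕ) : Prog :=
  .seq (.const 7 ρ) (.seq (.add 7 7 2) (.seq (emit 7)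
    (.seq (.add 7 2 2) (.seq (.add 7 7 3) (emit 7)))))

theorem haltsWithin_emitSizes (h : Core μ m n e p s) (h0 : m p = ρ + n)
    (h1 : m (p + 1) = n + n + e) :
    HaltsWithin P time (emitSizes ρ) 8 (Core μ m n e (p + 2)) s := by
  refine HaltsWithin.mono (T := 1 + (1 + (2 + (1 + (1 + 2))))) (.seq (.const (.seq (.add ?_))))
    (by omega) fun _ => id
  refine .seq_of (haltsWithin_emit (y := 7)
    ((h.setReg (by decide) _).setReg (by decide) _) (by simp [h0, h.nV])) ?_
  rintro s1 ⟨c1, -⟩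
  refine .seq (.add (.seq (.add ?_)))
  exact (haltsWithin_emit (y := 7) ((c1.setReg (by decide) _).setReg (by decide) _)
    (by simp [h1, c1.nV, c1.nE])).mono le_rfl fun _ h => h.1

end Writing

end SubspaceIso

namespace SubspaceIso

/-! ## The program for graph isomorphism -/

section Program

variable {n e : ℕ}

/-- Write the instance, whose header is written by `hdr`, and ask about it. -/
def writeAndQuery (ρ : ℕ) (hdr : Prog) : Prog :=
  .seq hdr (.seq (emitGraph ρ (.const 11 4)) (.seq (emitGraph ρ secondOffset) (.query 0 1)))

/-- Register `7` becomes zero if and only if the two graphs have the same size. -/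
def compareSizes : Prog :=
  .seq (.sub 7 2 12) (.seq (.sub 8 12 2) (.seq (.add 7 7 8) (.seq (.sub 8 3 13)
    (.seq (.add 7 7 8) (.seq (.sub 8 13 3) (.add 7 7 8))))))

/-- Read the sizes of the graphs. -/
def readSizes : Prog :=
  .seq (.const 1 1) (.seq (.read 2 0 0) (.seq (.read 3 0 1) (.seq (.const 7 2)
    (.seq (.read 12 0 7) (.seq (.const 7 3) (.read 13 0 7))))))

/-- The program deciding graph isomorphism. -/
def decideIso (ρ : ℕ) (hdr : Prog) : Prog :=
  .seq readSizes (.seq compareSizes (.ite 7 .skip (.ite 2 (writeAndQuery ρ hdr) (.const 0 1))))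

/-- A bound for the time of writing the instance. -/
def writeTime (ρ n e : ℕ) : ℕ :=
  (blockTime ρ n n + (blockTime ρ n n + (1 + blockTime ρ n e))) +
    (blockTime ρ n n + (blockTime ρ n n + (3 * n + 3 + blockTime ρ n e)))

variable {P : DecisionProblem} {time : P.Inst → ℕ}

/-- The problem `P` has an instance, with a header of length `base` written by `hdr` in time `Th`,
which consists of the tuples attached to two graphs, and which asks for their isomorphism. -/
structure Encodes (P : DecisionProblem) (ρ base Th : ℕ) (hdr : Prog) {g g' : SimpleGraph (Fin n)}
    (l : Fin e ≃ g.edgeSet) (l' : Fin e ≃ g'.edgeSet) (x : P.Inst) (m : ℕ → ℕ) : Prop where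
  size : P.size x = 2 * (ρ + 1) * (ρ + n) * (n + n + e)
  yes : P.yes x ↔ Nonempty (g ≃g g')
  fst : HoldsBits m base (tuple ρ g l)
  snd : HoldsBits m (base + (n + n + e) * (ρ + n) * (ρ + 1)) (tuple ρ g' l')
  holds : ∀ m' : ℕ → ℕ, (∀ k < base + (n + n + e) * (ρ + n) * (ρ + 1) +
    (n + n + e) * (ρ + n) * (ρ + 1), m' k = m k) → P.holds m' x
  hdr : ∀ (time : P.Inst → ℕ) (μ : ℕ → ℕ) (s : State), Core μ m n e 0 s →
    HaltsWithin P time hdr Th (Core μ m n e base) s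

theorem haltsWithin_writeAndQuery {ρ base Th : ℕ} {hdr : Prog} {g g' : SimpleGraph (Fin n)}
    {l : Fin e ≃ g.edgeSet} {l' : Fin e ≃ g'.edgeSet} {x : P.Inst} {m μ : ℕ → ℕ} {s : State}
    (hx : Encodes P ρ base Th hdr l l' x m)
    (hμ : graphIsomorphism.holds μ (⟨n, e, g, l⟩, ⟨n, e, g', l'⟩)) (h : Core μ m n e 0 s) :
    HaltsWithin P time (writeAndQuery ρ hdr) (Th + (writeTime ρ n e + (time x + 1)))
      (fun s' => (Nonempty (g ≃g g') → s'.reg 0 = 1) ∧ (¬ Nonempty (g ≃g g') → s'.reg 0 = 0))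
      s := by
  obtain ⟨-, -, -, -, hG, hH⟩ := hμ
  refine .seq_of (hx.hdr time μ s h) fun s1 h1 => ?_
  unfold writeTime
  rw [Nat.add_assoc]
  refine .seq_of (haltsWithin_emitGraph hG hx.fst h1 fun p s hs => ?_) fun s2 h2 => ?_
  · exact .const ⟨hs.setReg (by decide) _, by simp⟩
  refine .seq_of (haltsWithin_emitGraph hH hx.snd h2
    fun p s hs => haltsWithin_secondOffset hs) fun s3 h3 => ?_
  refine .query (hx.holds _ h3.output) (fun hy => ⟨fun _ => by simp, fun hn => ?_⟩)
    fun hy => ⟨fun hn => ?_, fun _ => by simp⟩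
  · exact absurd (hx.yes.1 hy) hn
  · exact absurd (hx.yes.2 hn) hy

/-- A sum of truncated differences, taken in both directions, vanishes exactly when the compared
numbers agree. -/
theorem haltsWithin_compareSizes {s : State} :
    HaltsWithin P time compareSizes 7 (fun s' =>
      (s'.reg 7 = 0 ↔ s.reg 2 = s.reg 12 ∧ s.reg 3 = s.reg 13) ∧ s'.arr = s.arr ∧
        ∀ x, x ≠ 7 → x ≠ 8 → s'.reg x = s.reg x) s := by
  refine .seq (.sub (.seq (.sub (.seq (.add (.seq (.sub (.seq (.add (.seq (.sub (.add
    ⟨?_, rfl, ?_⟩))))))))))))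
  · simp only [State.setReg_reg]
    norm_num
    omega
  · intro x h7 h8
    simp [h7, h8]

theorem haltsWithin_readSizes {s : State} (h0 : s.reg 0 = 0) :
    HaltsWithin P time readSizes 7 (fun s' =>
      s'.reg 1 = 1 ∧ s'.reg 2 = s.arr 0 0 ∧ s'.reg 3 = s.arr 0 1 ∧ s'.reg 12 = s.arr 0 2 ∧
      s'.reg 13 = s.arr 0 3 ∧ s'.arr = s.arr ∧ s'.reg 0 = s.reg 0 ∧ s'.reg 4 = s.reg 4) s := by
  refine .seq (.const (.seq (.read (.seq (.read (.seq (.const (.seq (.read (.seq (.const (.read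
    ⟨?_, ?_, ?_, ?_, ?_, rfl, ?_, ?_⟩)))))))))))) <;> simp [h0]

theorem haltsWithin_decideIso {ρ base Th : ℕ} {hdr : Prog}
    (hP : ∀ {n e : ℕ} {g g' : SimpleGraph (Fin n)} (l : Fin e ≃ g.edgeSet)
      (l' : Fin e ≃ g'.edgeSet), 0 < n → ∃ x m, Encodes P ρ base Th hdr l l' x m)
    {B : ℕ → ℕ → ℕ} (hB : ∀ (x : P.Inst) (n e : ℕ),
      P.size x = 2 * (ρ + 1) * (ρ + n) * (n + n + e) → time x ≤ B n e)
    (G H : LabelledGraph) (s : State) (hGH : graphIsomorphism.holds (s.arr 0) (G, H))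
    (hreg : ∀ x, s.reg x = 0) :
    HaltsWithin P time (decideIso ρ hdr)
      (Th + (writeTime ρ G.nV G.nE + (B G.nV G.nE + 1)) + 17)
      (fun s' => (graphIsomorphism.yes (G, H) → s'.reg 0 = 1) ∧
        (¬ graphIsomorphism.yes (G, H) → s'.reg 0 = 0)) s := by
  obtain ⟨n, e, g, l⟩ := G
  obtain ⟨n', e', g', l'⟩ := H
  have hGH' := hGH
  obtain ⟨hn, he, hn', he', -, -⟩ := hGH'
  dsimp only at hn he hn' he'
  refine HaltsWithin.mono
    (T := 7 + (7 + ((Th + (writeTime ρ n e + (B n e + 1))) + 1 + 1 + 1))) ?_ (by dsimp only; omega)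
    fun _ => id
  refine .seq_of (haltsWithin_readSizes (hreg 0)) ?_
  rintro s1 ⟨h11, h12, h13, h1_12, h1_13, h1a, h10, h14⟩
  refine .seq_of haltsWithin_compareSizes ?_
  rintro s2 ⟨h27, h2a, h2f⟩
  rw [h12, h13, h1_12, h1_13, hn, he, hn', he'] at h27
  have h20 : s2.reg 0 = 0 := by rw [h2f 0 (by decide) (by decide), h10, hreg]
  have h22 : s2.reg 2 = n := by rw [h2f 2 (by decide) (by decide), h12, hn]
  by_cases hsize : n = n' ∧ e = e'
  · obtain ⟨rfl, rfl⟩ := hsize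
    refine HaltsWithin.mono (.ite_zero (h27.2 ⟨rfl, rfl⟩) (T := Th + (writeTime ρ n e +
      (B n e + 1)) + 1) ?_) (by omega) fun _ => id
    -- Graphs without vertices need not yield a legal instance, so they are answered directly: they
    -- are isomorphic.
    rcases Nat.eq_zero_or_pos n with rfl | hpos
    · refine .ite_zero h22 (.mono (.const ?_) (by omega) fun _ => id)
      have : Nonempty (g ≃g g') := ⟨⟨Equiv.refl _, fun {a} => a.elim0⟩⟩
      exact ⟨fun _ => by simp, fun h => absurd this h⟩
    · obtain ⟨x, m, hx⟩ := hP l l' hpos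
      refine .ite_nonzero (by omega) ?_
      refine (haltsWithin_writeAndQuery hx hGH ?_).mono ?_ fun _ => id
      · constructor
        · exact h20
        · rw [h2f 1 (by decide) (by decide), h11]
        · exact h22
        · rw [h2f 3 (by decide) (by decide), h13, he]
        · rw [h2f 4 (by decide) (by decide), h14, hreg]
        · rw [h2a, h1a]
        · intro k hk
          omega
      · have := hB x n e hx.size
        omega
  -- For different sizes the answer is no, and register `0` is still zero.
  · refine HaltsWithin.mono (.ite_nonzero (fun h => hsize (h27.1 h))
      (.skip ⟨fun h => ?_, fun _ => h20⟩)) (by omega) fun _ => id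
    obtain ⟨f⟩ : Nonempty (g ≃g g') := h
    refine absurd ⟨?_, ?_⟩ hsize
    · simpa using Fintype.card_congr f.toEquiv
    · simpa using Fintype.card_congr (l.trans (f.mapEdgeSet.trans l'.symm))

/-! ### The polynomial runtime bound -/

theorem eval_mono_nat (q : Polynomial ℕ) {a b : ℕ} (h : a ≤ b) : q.eval a ≤ q.eval b := by
  rw [Polynomial.eval_eq_sum, Polynomial.eval_eq_sum]
  exact Finset.sum_le_sum fun i _ => Nat.mul_le_mul_left _ (Nat.pow_le_pow_left h i)

theorem blockTime_mono {ρ n k N : ℕ} (hn : n ≤ N) (hk : k ≤ N) :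
    blockTime ρ n k ≤ blockTime ρ N N := by
  unfold blockTime matrixTime
  gcongr

theorem giHard_of_encodes {ρ base Th : ℕ} {hdr : Prog}
    (hP : ∀ {n e : ℕ} {g g' : SimpleGraph (Fin n)} (l : Fin e ≃ g.edgeSet)
      (l' : Fin e ≃ g'.edgeSet), 0 < n → ∃ x m, Encodes P ρ base Th hdr l l' x m) :
    GIHard P := by
  refine ⟨decideIso ρ hdr, fun time ⟨q, hq⟩ => ?_⟩
  let X : Polynomial ℕ := Polynomial.X
  let bt : Polynomial ℕ := X * (3 * (ρ * (ρ + 1)) + X * (3 * ρ + 10) + 6 + 1) + 2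
  have hbt : ∀ N, bt.eval N = blockTime ρ N N := fun N => by
    simp [bt, X, blockTime, matrixTime]
  -- Three blocks for each of two graphs, `3n` for the second offset, the black box on the instance
  -- size, and the header. The constant is `22 = 17 + 1 + 3 + 1`: tests and size comparison, the two
  -- offsets, the query.
  refine ⟨6 * bt + 3 * X + q.comp (2 * (ρ + 1) * (ρ + X) * (X + X + X)) + Th + 22, ?_⟩
  intro G H s hGH hreg _
  obtain ⟨t, s', h1, h2, h3⟩ := haltsWithin_decideIso (time := time) hP
    (B := fun n e => q.eval (2 * (ρ + 1) * (ρ + n) * (n + n + e)))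
    (fun x n e hx => by rw [← hx]; exact hq x) G H s hGH hreg
  refine ⟨t, s', h1, h2.trans ?_, h3⟩
  generalize hN : G.nV + G.nE + H.nV + H.nE = N
  have hn : G.nV ≤ N := by omega
  have he : G.nE ≤ N := by omega
  have hb1 := blockTime_mono (ρ := ρ) hn hn
  have hb2 := blockTime_mono (ρ := ρ) hn he
  have hq' : q.eval (2 * (ρ + 1) * (ρ + G.nV) * (G.nV + G.nV + G.nE)) ≤
      q.eval (2 * (ρ + 1) * (ρ + N) * (N + N + N)) := eval_mono_nat q (by gcongr)
  have hp : (6 * bt + 3 * X + q.comp (2 * (ρ + 1) * (ρ + X) * (X + X + X)) + Th + 22 :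
      Polynomial ℕ).eval N = 6 * blockTime ρ N N + 3 * N +
        q.eval (2 * (ρ + 1) * (ρ + N) * (N + N + N)) + Th + 22 := by
    simp [hbt, X, Polynomial.eval_comp]
  rw [hp, writeTime]
  omega

end Program

/-! ## Hardness -/

section Hardness

theorem HoldsBits.congr {m m' : ℕ → ℕ} {base n d r : ℕ} {A : Fin n → Matrix (Fin d) (Fin r) Bool}
    (h : HoldsBits m base A) (hm : ∀ k < base + n * d * r, m' k = m k) : HoldsBits m' base A :=
  fun i a b => (hm _ (Nat.add_lt_add_left (index_lt i a b) base)).trans (h i a b)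

variable (F : Type*) [Field F]

theorem giHard_problemU (ρ : ℕ) (σ : F ≃+* F) : GIHard (problemU (ρ + 1) F σ) := by
  refine giHard_of_encodes (ρ := ρ) (base := 2) (Th := 8) (hdr := emitSizes ρ)
    fun {n e g g'} l l' hn => ?_
  let x : (problemU (ρ + 1) F σ).Inst :=
    InstU.mk (ρ + n) (n + n + e) (by omega) (by omega) (graphPair ρ F l l')
  -- Any memory representing the instance serves as the target that the program reproduces.
  obtain ⟨m, hm⟩ := (problemU (ρ + 1) F σ).holds_exists x
  have hm' := hm
  obtain ⟨h0, h1, hA, hB⟩ := hm'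
  refine ⟨x, m, rfl, commonOrbit_iff (fun τ => permGL_mem_unitary σ τ) l l', hA, hB,
    fun m' h => ⟨?_, ?_, hA.congr fun k hk => h k (Nat.lt_add_right _ hk), hB.congr h⟩,
    fun time μ s hs => haltsWithin_emitSizes hs h0 h1⟩
  · exact (h 0 (by omega)).trans h0
  · exact (h 1 (by omega)).trans h1

theorem giHard_problemGL : GIHard (problemGL F) := by
  -- Here `r` is part of the instance, so lines suffice: `r = 1` is the extra header entry, copied
  -- from register `1`.
  refine giHard_of_encodes (ρ := 0) (base := 3) (Th := 10) (hdr := .seq (emit 1) (emitSizes 0))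
    fun {n e g g'} l l' hn => ?_
  let x : (problemGL F).Inst :=
    InstGL.mk (0 + 1) (0 + n) (n + n + e) (by omega) (by omega) (by omega) (graphPair 0 F l l')
  obtain ⟨m, hm⟩ := (problemGL F).holds_exists x
  have hm' := hm
  obtain ⟨h0, h1, h2, hA, hB⟩ := hm'
  refine ⟨x, m, rfl, commonOrbit_iff (fun τ => Subgroup.mem_top _) l l', hA, hB,
    fun m' h => ⟨?_, ?_, ?_, hA.congr fun k hk => h k (Nat.lt_add_right _ hk), hB.congr h⟩,
    fun time μ s hs => .seq_of (haltsWithin_emit hs (by rw [hs.one]; exact h0))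
      fun s1 h => haltsWithin_emitSizes h.1 h1 h2⟩
  · exact (h 0 (by omega)).trans h0
  · exact (h 1 (by omega)).trans h1
  · exact (h 2 (by omega)).trans h2

end Hardness

end SubspaceIso

theorem mainTheorem5 (F : Type*) [Field F] :
    (∀ (r : ℕ) (σ : F ≃+* F), 1 ≤ r → Function.Involutive σ →
      SubspaceIso.GIHard (SubspaceIso.problemU r F σ)) ∧
    SubspaceIso.GIHard (SubspaceIso.problemGL F) := by
  refine ⟨fun r σ hr _ => ?_, SubspaceIso.giHard_problemGL F⟩
  obtain ⟨ρ, rfl⟩ := Nat.exists_eq_add_of_le' hr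
  exact SubspaceIso.giHard_problemU F ρ σ
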